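/- Let $0<q<1$. An entire function $f:\mathbb{C}\to\mathbb{C}$ is said to have $q$-exponential growth of order $k$ and type $\alpha$ ($k,\alpha\in\mathbb{R}$) if there is $K>0$ with $$|f(x)|<K\,|x|^{\alpha}\exp\!\left(\frac{k\ln^2|x|}{2\ln^2 q}\right)\qquad(x\in\mathbb{C}\setminus\{0\}).$$ For an entire function $f$ put $\breve f(z)=f\big((z+1/z)/2\big)$, $z\neq0$. The Askey–Wilson operator is $$\mathcal{D}_qf(x)=\frac{\breve f(q^{1/2}z)-\breve f(q^{-1/2}z)}{(q^{1/2}-q^{-1/2})\,(z-1/z)/2},\qquad x=\tfrac12(z+1/z),$$ (for $z=e^{i\theta}$, $x=\cos\theta$ and $(z-1/z)/2=i\sin\theta$), with the values at $x=\pm1$ defined by the limit. Let $(a;q)_n=\prod_{j=0}^{n-1}(1-aq^j)$, let $\rho_0(x)=1$, and for $n\ge1$ let $$\rho_n(x)=(1+z^2)\,(-q^{2-n}z^2;q^2)_{n-1}\,z^{-n},\qquad x=\tfrac12(z+1/z).$$ These definitions do not depend on the choice of $z$. Theorem. Suppose that $f$ is an entire function of $q$-exponential growth either of some order $k<2\ln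 q^{-1}$ (and some type $\alpha\in\mathbb{R}$), or of order $2\ln q^{-1}$ and some type $\alpha<\dfrac{2\ln 2}{\ln q^{-1}}$. Then for every $x\in\mathbb{C}$ $$f(x)=\sum_{k=0}^{\infty}f_k\,\rho_k(x),\qquad f_k=\frac{q^{(k^2-k)/4}(1-q)^k}{2^k\,(q;q)_k}\,(\mathcal{D}_q^kf)(0),$$ where the series converges (absolutely). -/

import Mathlib

noncomputable section

namespace AskeyWilson

/-- The finite `q`-shifted factorial `(a; q)_n = ∏_{j < n} (1 - a q ^ j)`. -/
def qPoch (a q : ℂ) (n : ℕ) : ℂ := ∏ j ∈ Finset.range n, (1 - a * q ^ j)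

/-- The map `z ↦ (z + 1 / z) / 2`; with `z = e ^ (i θ)` it is `cos θ`. -/
def jouk (z : ℂ) : ℂ := (z + z⁻¹) / 2

/-- A solution `z = e ^ (i θ)` of `x = (z + 1 / z) / 2 = cos θ`. The other one is `1 / z`; nothing
below depends on the choice, see `awQuot_inv`, `awD_jouk` and `rho_jouk`. -/
def zOf (x : ℂ) : ℂ := x + (x ^ 2 - 1) ^ (1 / 2 : ℂ)

/-- The Askey-Wilson divided difference
`(f˘(q^(1/2) z) - f˘(q^(-1/2) z)) / ((q^(1/2) - q^(-1/2)) * i sin θ)`, where `z = e ^ (i θ)`,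
`f˘(z) = f((z + 1 / z) / 2)` and `i sin θ = (z - 1 / z) / 2`. -/
def awQuot (q : ℝ) (f : ℂ → ℂ) (z : ℂ) : ℂ :=
  (f (jouk ((√q : ℝ) * z)) - f (jouk ((√q : ℝ)⁻¹ * z))) /
    (((√q : ℝ) - (√q : ℝ)⁻¹) * ((z - z⁻¹) / 2))

open Classical in
/-- The Askey-Wilson operator `𝒟_q`. At `x = 1` and `x = -1`, where `sin θ = 0`, its value is the
limit of the divided differences. -/
def awD (q : ℝ) (f : ℂ → ℂ) (x : ℂ) : ℂ :=
  if x = 1 ∨ x = -1 then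
    Filter.limUnder (nhdsWithin x {x}ᶜ) (fun y => awQuot q f (zOf y))
  else awQuot q f (zOf x)

/-- The expression `(1 + z²) (-q^(2-n) z²; q²)_{n-1} z^(-n)` for `n ≥ 1`, and `1` for `n = 0`. -/
def rhoZ (q : ℝ) (n : ℕ) (z : ℂ) : ℂ :=
  if n = 0 then 1
  else (1 + z ^ 2) * qPoch (-(q : ℂ) ^ (2 - (n : ℤ)) * z ^ 2) ((q : ℂ) ^ 2) (n - 1) * (z ^ n)⁻¹

/-- The polynomial `ρ_n` in `x = cos θ`. -/
def rho (q : ℝ) (n : ℕ) (x : ℂ) : ℂ := rhoZ q n (zOf x)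

/-- The coefficient `f_k = q^((k² - k)/4) (1 - q)^k / (2^k (q; q)_k) * (𝒟_q^k f)(0)`. -/
def taylorCoeff (q : ℝ) (f : ℂ → ℂ) (k : ℕ) : ℂ :=
  ((q ^ (((k : ℝ) ^ 2 - k) / 4) : ℝ) : ℂ) * (1 - q) ^ k / (2 ^ k * qPoch q q k) *
    ((awD q)^[k] f) 0

/-- `f` is an entire function of `q`-exponential growth of order `k` and type `α`:
`|f(x)| < K |x|^α exp(k ln² |x| / (2 ln² q))` for some `K > 0`. -/
def HasQExpGrowth (q k α : ℝ) (f : ℂ → ℂ) : Prop :=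
  Differentiable ℂ f ∧ ∃ K : ℝ, 0 < K ∧ ∀ x : ℂ, x ≠ 0 →
    ‖f x‖ < K * ‖x‖ ^ α * Real.exp (k * Real.log ‖x‖ ^ 2 / (2 * Real.log q ^ 2))

theorem zOf_mul (x : ℂ) : zOf x * (x - (x ^ 2 - 1) ^ (1 / 2 : ℂ)) = 1 := by
  have h : ((x ^ 2 - 1) ^ (1 / 2 : ℂ)) ^ 2 = x ^ 2 - 1 := by
    rw [one_div]
    exact Complex.cpow_nat_inv_pow (x ^ 2 - 1) (n := 2) (by norm_num)
  unfold zOf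
  linear_combination -h

theorem zOf_ne_zero (x : ℂ) : zOf x ≠ 0 := left_ne_zero_of_mul_eq_one (zOf_mul x)

theorem jouk_zOf (x : ℂ) : jouk (zOf x) = x := by
  have h := eq_inv_of_mul_eq_one_right (zOf_mul x)
  unfold jouk
  rw [← h]
  unfold zOf
  ring

theorem zOf_jouk {z : ℂ} (hz : z ≠ 0) : zOf (jouk z) = z ∨ zOf (jouk z) = z⁻¹ := by
  have h := jouk_zOf (jouk z)
  have h0 := zOf_ne_zero (jouk z)
  generalize zOf (jouk z) = w at h h0
  unfold jouk at h
  field_simp at h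
  have : (w - z) * (w * z - 1) = 0 := by linear_combination h
  rcases mul_eq_zero.1 this with h1 | h1
  · exact Or.inl (sub_eq_zero.1 h1)
  · exact Or.inr (eq_inv_of_mul_eq_one_left (sub_eq_zero.1 h1))

theorem jouk_inv (z : ℂ) : jouk z⁻¹ = jouk z := by
  unfold jouk
  rw [inv_inv, add_comm]

theorem awQuot_inv (q : ℝ) (f : ℂ → ℂ) (z : ℂ) : awQuot q f z⁻¹ = awQuot q f z := by
  have h1 : jouk ((√q : ℝ) * z⁻¹) = jouk ((√q : ℝ)⁻¹ * z) := by
    rw [← jouk_inv]; simp [mul_comm]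
  have h2 : jouk ((√q : ℝ)⁻¹ * z⁻¹) = jouk ((√q : ℝ) * z) := by
    rw [← jouk_inv]; simp [mul_comm]
  unfold awQuot
  rw [h1, h2, inv_inv, ← neg_div_neg_eq]
  congr 1 <;> ring

theorem awD_jouk (q : ℝ) (f : ℂ → ℂ) {z : ℂ} (hz : z ≠ 0) (hz2 : z ^ 2 ≠ 1) :
    awD q f (jouk z) = awQuot q f z := by
  have h : ¬ (jouk z = 1 ∨ jouk z = -1) := by
    rintro (h | h) <;> unfold jouk at h <;> field_simp at h <;> apply hz2
    · have : (z - 1) ^ 2 = 0 := by linear_combination h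
      have := pow_eq_zero_iff (two_ne_zero) |>.1 this
      linear_combination (z + 1) * this
    · have : (z + 1) ^ 2 = 0 := by linear_combination h
      have := pow_eq_zero_iff (two_ne_zero) |>.1 this
      linear_combination (z - 1) * this
  unfold awD
  rw [if_neg h]
  rcases zOf_jouk hz with h | h <;> rw [h]
  exact awQuot_inv q f z

theorem rhoZ_inv {q : ℝ} (hq : 0 < q) (n : ℕ) {z : ℂ} (hz0 : z ≠ 0) :
    rhoZ q n z⁻¹ = rhoZ q n z := by
  unfold rhoZ
  split_ifs with hn
  · rfl
  obtain ⟨m, rfl⟩ := Nat.exists_eq_succ_of_ne_zero hn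
  have hq' : (q : ℂ) ≠ 0 := by exact_mod_cast hq.ne'
  have key : qPoch (-(q : ℂ) ^ (2 - ((m + 1 : ℕ) : ℤ)) * z⁻¹ ^ 2) ((q : ℂ) ^ 2) m * z ^ (2 * m) =
      qPoch (-(q : ℂ) ^ (2 - ((m + 1 : ℕ) : ℤ)) * z ^ 2) ((q : ℂ) ^ 2) m := by
    have hprod : ∏ j ∈ Finset.range m, (q : ℂ) ^ (1 - (m : ℤ) + 2 * j) = 1 := by
      have h1 := Finset.prod_range_reflect (fun j : ℕ => (q : ℂ) ^ (1 - (m : ℤ) + 2 * j)) m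
      have h2 : ∏ j ∈ Finset.range m, (q : ℝ) ^ (1 - (m : ℤ) + 2 * j) *
          q ^ (1 - (m : ℤ) + 2 * ((m - 1 - j : ℕ) : ℤ)) = 1 := by
        apply Finset.prod_eq_one
        intro j hj
        have := Finset.mem_range.1 hj
        rw [← zpow_add₀ hq.ne', show (1 - (m : ℤ) + 2 * j) + (1 - (m : ℤ) + 2 * ((m - 1 - j : ℕ) : ℤ))
          = 0 by omega, zpow_zero]
      rw [Finset.prod_mul_distrib,
        Finset.prod_range_reflect (fun j : ℕ => (q : ℝ) ^ (1 - (m : ℤ) + 2 * j)) m,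
        ← pow_two] at h2
      have h3 : (∏ j ∈ Finset.range m, (q : ℝ) ^ (1 - (m : ℤ) + 2 * j)) = 1 :=
        (pow_eq_one_iff_of_nonneg (Finset.prod_nonneg fun j _ => (zpow_pos hq _).le)
          two_ne_zero).1 h2
      exact_mod_cast congrArg (fun r : ℝ => (r : ℂ)) h3
    have hL : qPoch (-(q : ℂ) ^ (2 - ((m + 1 : ℕ) : ℤ)) * z⁻¹ ^ 2) ((q : ℂ) ^ 2) m =
        ∏ j ∈ Finset.range m, (1 - -(q : ℂ) ^ (2 - ((m + 1 : ℕ) : ℤ)) * z⁻¹ ^ 2 *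
          ((q : ℂ) ^ 2) ^ (m - 1 - j)) := by
      unfold qPoch
      exact (Finset.prod_range_reflect (fun j : ℕ => (1 - -(q : ℂ) ^ (2 - ((m + 1 : ℕ) : ℤ)) *
        z⁻¹ ^ 2 * ((q : ℂ) ^ 2) ^ j)) m).symm
    have hz : z ^ (2 * m) = ∏ j ∈ Finset.range m, z ^ 2 := by
      rw [Finset.prod_const, Finset.card_range, pow_mul]
    rw [hL, hz, ← Finset.prod_mul_distrib]
    refine (mul_one _).symm.trans ?_
    refine (congrArg _ hprod.symm).trans ?_
    rw [← Finset.prod_mul_distrib]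
    unfold qPoch
    refine Finset.prod_congr rfl fun j hj => ?_
    have hj := Finset.mem_range.1 hj
    have e1 : (q : ℂ) ^ (2 - ((m + 1 : ℕ) : ℤ)) * ((q : ℂ) ^ 2) ^ (m - 1 - j) *
        (q : ℂ) ^ (1 - (m : ℤ) + 2 * j) = 1 := by
      rw [← pow_mul, ← zpow_natCast, ← zpow_add₀ hq', ← zpow_add₀ hq']
      rw [show (2 - ((m + 1 : ℕ) : ℤ)) + ((2 * (m - 1 - j) : ℕ) : ℤ) + (1 - (m : ℤ) + 2 * j) = 0
        by omega, zpow_zero]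
    have e2 : (q : ℂ) ^ (1 - (m : ℤ) + 2 * j) =
        (q : ℂ) ^ (2 - ((m + 1 : ℕ) : ℤ)) * ((q : ℂ) ^ 2) ^ j := by
      rw [← pow_mul, ← zpow_natCast, ← zpow_add₀ hq']
      congr 1
      push_cast
      ring
    have e3 : z⁻¹ ^ 2 * z ^ 2 = 1 := by rw [← mul_pow, inv_mul_cancel₀ hz0, one_pow]
    linear_combination z ^ 2 * e2 + (z⁻¹ ^ 2 * z ^ 2) * e1 + e3
  simp only [Nat.succ_eq_add_one, Nat.add_sub_cancel]
  rw [← key]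
  generalize qPoch _ _ _ = P
  have hw : z * z⁻¹ = 1 := mul_inv_cancel₀ hz0
  have h4 : (z⁻¹ ^ (m + 1))⁻¹ = z ^ (m + 1) := by rw [inv_pow, inv_inv]
  have h5 : z ^ (2 * m) * (z ^ (m + 1))⁻¹ * z ^ 2 = z ^ (m + 1) := by
    rw [mul_right_comm, ← pow_add, show 2 * m + 2 = (m + 1) + (m + 1) by ring, pow_add,
      mul_assoc, mul_inv_cancel₀ (pow_ne_zero _ hz0), mul_one]
  rw [h4, ← h5]
  field_simp
  ring

theorem rho_jouk {q : ℝ} (hq : 0 < q) (n : ℕ) {z : ℂ} (hz : z ≠ 0) :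
    rho q n (jouk z) = rhoZ q n z := by
  unfold rho
  rcases zOf_jouk hz with h | h <;> rw [h]
  exact rhoZ_inv hq n hz

end AskeyWilson

end

noncomputable section

namespace AskeyWilson

open Complex Finset

/-! Put `s = √q`. The value of `𝒟_q f` at `node s m` needs only `f` at `node s (m ± 1)`, so `(𝒟_q^n
f)(0)` is a multiple of the divided difference of `f` at the nodes of index -n, -n+2, ..., n. By
Cauchy's formula it is an integral of `f` against `diffConst s n / nodeProd s n 0`
(`iterate_awD_node`). As `ρ_n = 2^n nodal s n` (`rho_eq_nodal`), the n-th term of the series is the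
integral of f(w) against w nodal_n(x) / nodal_{n+2}(w), and these kernels telescope towards 1 / (w -
x) (`inv_sub_eq_sum_nodal`).

The remainder after N terms is therefore a contour integral over |w| = q^(-N/2)
(`sub_sum_taylor_eq`). With q = exp(-2l) and n = N or N + 1, up to constants, |f(w)| is at most
exp(αNl + N²l/2), |nodal_n(x)| at most exp(l(n-1)²/2 - n log 2), and |nodal_n(w)| at least exp(nNl).
The terms quadratic in N cancel, and what is left is O(exp(αl - log 2)^N), a decaying geometric
sequence because the critical type is log 2 / l. -/

/-! ### Interpolation nodes. -/

/-- The interpolation nodes `(i s ^ m + 1 / (i s ^ m)) / 2`, `m ∈ ℤ`, where `s = √q`. -/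
def node (s : ℝ) (m : ℤ) : ℂ := jouk (I * (s : ℂ) ^ m)

/-- The monic multiple of `ρ_n`. -/
def nodal (s : ℝ) : ℕ → ℂ → ℂ
  | 0, _ => 1
  | 1, x => x
  | n + 2, x => nodal s n x * (x ^ 2 - node s n ^ 2)

theorem node_eq (s : ℝ) (m : ℤ) :
    node s m = I / 2 * ((s : ℂ) ^ m - (s : ℂ) ^ (-m)) := by
  rw [node, jouk, mul_inv, inv_I, zpow_neg]
  ring

theorem node_neg (s : ℝ) (m : ℤ) : node s (-m) = -node s m := by
  rw [node_eq, node_eq, neg_neg]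
  ring

theorem node_zero (s : ℝ) : node s 0 = 0 := by simp [node_eq]

theorem node_add_sub_node_sub {s : ℝ} (hs : 0 < s) (m j : ℤ) :
    node s (m + j) - node s (m - j) =
      I / 2 * ((s : ℂ) ^ j - (s : ℂ) ^ (-j)) * ((s : ℂ) ^ m + (s : ℂ) ^ (-m)) := by
  have hs' : (s : ℂ) ≠ 0 := by exact_mod_cast hs.ne'
  rw [node_eq, node_eq, show -(m + j) = -m + -j by ring, show -(m - j) = -m + j by ring,
    sub_eq_add_neg m j]
  simp only [zpow_add₀ hs']
  ring

theorem node_sq {s : ℝ} (hs : 0 < s) (m : ℤ) :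
    4 * node s m ^ 2 = 2 - ((s : ℂ) ^ 2) ^ m - ((s : ℂ) ^ 2) ^ (-m) := by
  have hs' : (s : ℂ) ≠ 0 := by exact_mod_cast hs.ne'
  have h : (s : ℂ) ^ m * (s : ℂ) ^ (-m) = 1 := by
    rw [← zpow_add₀ hs', add_neg_cancel, zpow_zero]
  have h2 (k : ℤ) : ((s : ℂ) ^ 2) ^ k = ((s : ℂ) ^ k) ^ 2 := by
    rw [← zpow_natCast, ← zpow_natCast, zpow_comm]
  rw [node_eq, h2, h2]
  linear_combination 2 * h + ((s : ℂ) ^ m - (s : ℂ) ^ (-m)) ^ 2 * I_sq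

theorem norm_node_lt {s : ℝ} (hs : 0 < s) (hs1 : s < 1) {m : ℤ} {N : ℕ} (h1 : -N < m)
    (h2 : m < N) : ‖node s m‖ < s ^ (-N : ℤ) := by
  have e1 : s ^ m < s ^ (-N : ℤ) := zpow_lt_zpow_right_of_lt_one₀ hs hs1 h1
  have e2 : s ^ (-m) < s ^ (-N : ℤ) := zpow_lt_zpow_right_of_lt_one₀ hs hs1 (by omega)
  rw [node_eq, norm_mul]
  have e3 : ‖(s : ℂ) ^ m - (s : ℂ) ^ (-m)‖ ≤ s ^ m + s ^ (-m) := by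
    refine (norm_sub_le _ _).trans_eq ?_
    rw [norm_zpow, norm_zpow, norm_real, Real.norm_of_nonneg hs.le]
  have e4 : ‖(I / 2 : ℂ)‖ = 1 / 2 := by simp
  rw [e4]
  linarith

theorem norm_node_le {s : ℝ} (hs : 0 < s) (hs1 : s < 1) (n : ℕ) :
    ‖node s n‖ ≤ s ^ (-n : ℤ) / 2 := by
  have e1 : s ^ (n : ℤ) ≤ s ^ (-n : ℤ) := zpow_le_zpow_right_of_le_one₀ hs hs1.le (by omega)
  have e0 : 0 < s ^ (n : ℤ) := zpow_pos hs _
  rw [node_eq, norm_mul]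
  have e3 : ‖(s : ℂ) ^ (n : ℤ) - (s : ℂ) ^ (-n : ℤ)‖ ≤ s ^ (-n : ℤ) := by
    rw [← ofReal_zpow, ← ofReal_zpow, ← ofReal_sub, norm_real, Real.norm_eq_abs, abs_le]
    constructor <;> linarith
  have e4 : ‖(I / 2 : ℂ)‖ = 1 / 2 := by simp
  rw [e4]
  linarith

/-! ### The polynomials ρ_n in terms of the nodes. -/

theorem rhoZ_add_two {q : ℝ} (hq : 0 < q) (n : ℕ) {z : ℂ} (hz : z ≠ 0) :
    rhoZ q (n + 2) z =
      rhoZ q n z * (z ^ 2 + (z ^ 2)⁻¹ + (q : ℂ) ^ (n : ℤ) + (q : ℂ) ^ (-n : ℤ)) := by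
  have hq' : (q : ℂ) ≠ 0 := by exact_mod_cast hq.ne'
  rcases n with _ | n
  · simp [rhoZ, qPoch]
    field_simp
    ring
  · have hP : qPoch (-(q : ℂ) ^ (2 - ((n + 1 + 2 : ℕ) : ℤ)) * z ^ 2) ((q : ℂ) ^ 2) (n + 2) =
        (1 + (q : ℂ) ^ (-(n + 1 : ℕ) : ℤ) * z ^ 2) *
          qPoch (-(q : ℂ) ^ (2 - ((n + 1 : ℕ) : ℤ)) * z ^ 2) ((q : ℂ) ^ 2) n *
          (1 + (q : ℂ) ^ ((n + 1 : ℕ) : ℤ) * z ^ 2) := by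
      unfold qPoch
      rw [prod_range_succ, prod_range_succ']
      have e (j : ℕ) (a b : ℤ) (h : a + 2 * j = b) :
          -(q : ℂ) ^ a * z ^ 2 * ((q : ℂ) ^ 2) ^ j = -((q : ℂ) ^ b * z ^ 2) := by
        rw [← h, zpow_add₀ hq', zpow_mul]
        norm_cast
        push_cast
        ring
      rw [e 0 _ (-(n + 1 : ℕ) : ℤ) (by push_cast; ring),
        e (n + 1) _ ((n + 1 : ℕ) : ℤ) (by push_cast; ring)]
      have : ∀ k ∈ range n, 1 - -(q : ℂ) ^ (2 - ((n + 1 + 2 : ℕ) : ℤ)) * z ^ 2 *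
          ((q : ℂ) ^ 2) ^ (k + 1) =
          1 - -(q : ℂ) ^ (2 - ((n + 1 : ℕ) : ℤ)) * z ^ 2 * ((q : ℂ) ^ 2) ^ k := by
        intro k _
        rw [e (k + 1) _ (2 - (n + 1 : ℕ) + 2 * k) (by push_cast; ring), e k _ _ rfl]
      rw [prod_congr rfl this]
      ring
    have hqn : (q : ℂ) ^ (-(n + 1 : ℕ) : ℤ) * (q : ℂ) ^ ((n + 1 : ℕ) : ℤ) = 1 := by
      rw [← zpow_add₀ hq', neg_add_cancel, zpow_zero]
    simp only [rhoZ, Nat.add_eq_zero_iff, one_ne_zero, and_false, OfNat.ofNat_ne_zero, if_false]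
    rw [show n + 1 + 2 - 1 = n + 2 by omega, show n + 1 - 1 = n by omega, hP]
    generalize qPoch _ _ _ = P
    generalize (q : ℂ) ^ (-(n + 1 : ℕ) : ℤ) = a at *
    generalize (q : ℂ) ^ ((n + 1 : ℕ) : ℤ) = b at *
    field_simp
    linear_combination (1 + z ^ 2) * P * z ^ (n + 7) * hqn

/-- Both sides satisfy a recursion of step two: the factor in `rhoZ_add_two` is 4(x² - node_n²),
since z² + z⁻² = 4x² - 2. -/
theorem rho_eq_nodal {s : ℝ} (hs : 0 < s) (x : ℂ) :
    ∀ n : ℕ, rho (s ^ 2) n x = 2 ^ n * nodal s n x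
  | 0 => by simp [rho, rhoZ, nodal]
  | 1 => by
    have h := jouk_zOf x
    have h0 := zOf_ne_zero x
    simp only [rho, nodal]
    generalize zOf x = z at h h0
    rw [← h]
    simp [rhoZ, qPoch, jouk]
    field_simp
    ring
  | n + 2 => by
    have ih := rho_eq_nodal hs x n
    have h := jouk_zOf x
    have h0 := zOf_ne_zero x
    simp only [rho, nodal] at ih ⊢
    rw [rhoZ_add_two (by positivity) n h0, ih]
    have h4 : zOf x ^ 2 + (zOf x ^ 2)⁻¹ = 4 * x ^ 2 - 2 := by
      conv_rhs => rw [← h]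
      unfold jouk
      field_simp
      ring
    have := node_sq hs n
    rw [h4]
    push_cast
    linear_combination 2 ^ n * nodal s n x * this

/-! ### Expansion of the Cauchy kernel and node products. -/

/-- Since (w² - node²) - (x² - node²) = w² - x², each summand is w / (w² - x²) times the drop of
nodal(x) / nodal(w) from n to n + 2. Telescoping by two leaves two boundary terms at each end; those
at 0 and 1 add up to 1 / (w - x). -/
theorem inv_sub_eq_sum_nodal {s : ℝ} {w x : ℂ} (N : ℕ) (hwx : w ^ 2 - x ^ 2 ≠ 0)
    (hw : ∀ n ≤ N + 1, nodal s n w ≠ 0) :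
    (w - x)⁻¹ = ∑ n ∈ range N, w * nodal s n x / nodal s (n + 2) w +
      w * (nodal s N x / nodal s N w + nodal s (N + 1) x / nodal s (N + 1) w) /
        (w ^ 2 - x ^ 2) := by
  induction N with
  | zero =>
    have hw1 : w ≠ 0 := by simpa [nodal] using hw 1 (by simp)
    have h1 : w - x ≠ 0 := fun h => hwx (by linear_combination (w + x) * h)
    simp only [nodal, range_zero, sum_empty]
    field_simp
    ring
  | succ N ih =>
    rw [ih fun n hn => hw n (by omega), sum_range_succ, add_assoc]
    congr 1
    have h2 := hw (N + 2) le_rfl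
    have h1 := hw (N + 1) (by omega)
    have h0 := hw N (by omega)
    have e : nodal s (N + 1 + 1) = nodal s (N + 2) := rfl
    rw [e]
    simp only [nodal] at h2 ⊢
    have h3 := right_ne_zero_of_mul h2
    field_simp
    ring

/-- The denominator of the `n`-th divided difference of `1 / (w - x)` around the `m`-th node. -/
def nodeProd (s : ℝ) (n : ℕ) (m : ℤ) (w : ℂ) : ℂ :=
  ∏ j ∈ range (n + 1), (w - node s (m + n - 2 * j))

/-- The node sets centred at m + 1 and m - 1 differ only in their extreme nodes; this and
`nodeProd_succ'` drive the divided-difference recursion. -/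
theorem nodeProd_succ (s : ℝ) (n : ℕ) (m : ℤ) (w : ℂ) :
    nodeProd s (n + 1) m w = nodeProd s n (m + 1) w * (w - node s (m - (n + 1 : ℕ))) := by
  unfold nodeProd
  rw [prod_range_succ]
  congr 1
  · refine prod_congr rfl fun j _ => ?_
    congr 2
    push_cast
    ring
  · congr 2
    push_cast
    ring

theorem nodeProd_succ' (s : ℝ) (n : ℕ) (m : ℤ) (w : ℂ) :
    nodeProd s (n + 1) m w = nodeProd s n (m - 1) w * (w - node s (m + (n + 1 : ℕ))) := by
  unfold nodeProd
  rw [prod_range_succ']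
  congr 1
  · refine prod_congr rfl fun j _ => ?_
    congr 2
    push_cast
    ring
  · simp

theorem mul_nodeProd_zero (s : ℝ) (w : ℂ) :
    ∀ n : ℕ, w * nodeProd s n 0 w = nodal s (n + 2) w
  | 0 => by simp [nodeProd, nodal, node_zero, sq]
  | 1 => by
    have e1 : node s (0 + (1 : ℕ) - 2 * (0 : ℕ)) = node s (1 : ℕ) := by simp
    have e2 : node s (0 + (1 : ℕ) - 2 * (1 : ℕ)) = -node s (1 : ℕ) := by
      rw [← node_neg]
      simp
    simp only [nodeProd, nodal, prod_range_succ, prod_range_zero]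
    rw [e1, e2]
    ring
  | n + 2 => by
    have h := mul_nodeProd_zero s w n
    rw [nodeProd_succ, nodeProd_succ', nodal, ← h]
    have e1 : node s (0 - ((n + 1 + 1 : ℕ) : ℤ)) = -node s ((n + 2 : ℕ) : ℤ) := by
      rw [zero_sub, node_neg]
    have e2 : node s (0 + 1 + ((n + 1 : ℕ) : ℤ)) = node s ((n + 2 : ℕ) : ℤ) := by
      congr 1
      push_cast
      ring
    rw [e1, e2, zero_add, sub_self]
    ring

/-- For n ≤ N + 1 only nodes of index at most N - 1 occur, all strictly inside the circle. -/
theorem nodal_ne_zero {s : ℝ} (hs : 0 < s) (hs1 : s < 1) {N : ℕ} {w : ℂ}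
    (hw : ‖w‖ = s ^ (-N : ℤ)) : ∀ n ≤ N + 1, nodal s n w ≠ 0
  | 0, _ => by simp [nodal]
  | 1, _ => by
    rw [nodal, ← norm_ne_zero_iff, hw]
    exact (zpow_pos hs _).ne'
  | n + 2, h => by
    refine mul_ne_zero (nodal_ne_zero hs hs1 hw n (by omega)) fun h0 => ?_
    have h1 := norm_node_lt hs hs1 (m := n) (N := N) (by omega) (by omega)
    have h2 : ‖w‖ ^ 2 = ‖node s n‖ ^ 2 := by
      rw [← norm_pow, ← norm_pow, sub_eq_zero.1 h0]
    rw [hw] at h2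
    have := (pow_left_inj₀ (zpow_pos hs _).le (norm_nonneg _) two_ne_zero).1 h2
    exact h1.ne' this

theorem nodeProd_ne_zero {s : ℝ} (hs : 0 < s) (hs1 : s < 1) {N n : ℕ} {m : ℤ} {w : ℂ}
    (hw : ‖w‖ = s ^ (-N : ℤ)) (h1 : -N < m - n) (h2 : m + n < N) : nodeProd s n m w ≠ 0 := by
  refine prod_ne_zero_iff.2 fun j hj h0 => ?_
  have hj := mem_range.1 hj
  have := norm_node_lt hs hs1 (m := m + n - 2 * j) (N := N) (by omega) (by omega)
  rw [← sub_eq_zero.1 h0, hw] at this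
  exact lt_irrefl _ this

theorem continuous_nodal (s : ℝ) : ∀ n, Continuous (nodal s n)
  | 0 => continuous_const
  | 1 => continuous_id
  | n + 2 => (continuous_nodal s n).mul (by fun_prop)

theorem continuous_nodeProd (s : ℝ) (n : ℕ) (m : ℤ) : Continuous (nodeProd s n m) := by
  unfold nodeProd
  fun_prop

/-! ### Iterates of the operator as divided differences. -/

/-- `∏_{j=1}^n (s^j - s^(-j)) / (s - s⁻¹)`. -/
def diffConst (s : ℝ) (n : ℕ) : ℂ :=
  ∏ j ∈ range n, ((s : ℂ) ^ ((j + 1 : ℕ) : ℤ) - (s : ℂ) ^ (-(j + 1 : ℕ) : ℤ)) / (s - (s : ℂ)⁻¹)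

theorem zpow_add_zpow_neg_ne_zero {s : ℝ} (hs : 0 < s) (m : ℤ) :
    (s : ℂ) ^ m + (s : ℂ) ^ (-m) ≠ 0 := by
  rw [← ofReal_zpow, ← ofReal_zpow, ← ofReal_add]
  exact_mod_cast (add_pos (zpow_pos hs m) (zpow_pos hs (-m))).ne'

theorem sub_inv_ne_zero {s : ℝ} (hs : 0 < s) (hs1 : s < 1) : (s : ℂ) - (s : ℂ)⁻¹ ≠ 0 := by
  rw [← ofReal_inv, ← ofReal_sub]
  have := (one_lt_inv₀ hs).2 hs1
  exact_mod_cast (by linarith : s - s⁻¹ < 0).ne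

theorem awD_node {s : ℝ} (hs : 0 < s) (g : ℂ → ℂ) (m : ℤ) :
    awD (s ^ 2) g (node s m) = (g (node s (m + 1)) - g (node s (m - 1))) /
      ((s - (s : ℂ)⁻¹) * (I / 2 * ((s : ℂ) ^ m + (s : ℂ) ^ (-m)))) := by
  have hs' : (s : ℂ) ≠ 0 := by exact_mod_cast hs.ne'
  have hz : I * (s : ℂ) ^ m ≠ 0 := mul_ne_zero I_ne_zero (zpow_ne_zero _ hs')
  -- The square of i s^m is negative, so a node is never ±1 and the limit in `awD` plays no role.
  have hz2 : (I * (s : ℂ) ^ m) ^ 2 ≠ 1 := by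
    intro h
    have h1 : (((s ^ m) ^ 2 : ℝ) : ℂ) = ((-1 : ℝ) : ℂ) := by
      push_cast
      linear_combination -h + ((s : ℂ) ^ m) ^ 2 * I_sq
    have h2 := ofReal_injective h1
    nlinarith [sq_nonneg (s ^ m)]
  rw [node, awD_jouk _ _ hz hz2, awQuot, Real.sqrt_sq hs.le, node, node]
  have e1 : ((s : ℝ) : ℂ) * (I * (s : ℂ) ^ m) = I * (s : ℂ) ^ (m + 1) := by
    rw [zpow_add_one₀ hs']
    ring
  have e2 : (s : ℂ)⁻¹ * (I * (s : ℂ) ^ m) = I * (s : ℂ) ^ (m - 1) := by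
    rw [zpow_sub_one₀ hs']
    ring
  have e3 : (I * (s : ℂ) ^ m - (I * (s : ℂ) ^ m)⁻¹) / 2 =
      I / 2 * ((s : ℂ) ^ m + (s : ℂ) ^ (-m)) := by
    rw [mul_inv, inv_I, zpow_neg]
    ring
  rw [e1, ofReal_inv, e2, e3]

/-- The bounds on m ± n keep every node involved inside the contour. In the inductive step, the
difference of two reciprocal node products is a multiple of the next one, and the factor depending
on m cancels the denominator of `awD_node`. -/
theorem iterate_awD_node {s : ℝ} (hs : 0 < s) (hs1 : s < 1) {f : ℂ → ℂ}
    (hf : Differentiable ℂ f) (N n : ℕ) :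
    ∀ m : ℤ, -N < m - n → m + n < N → ((awD (s ^ 2))^[n] f) (node s m) =
      (2 * Real.pi * I : ℂ)⁻¹ •
        ∮ w in C(0, s ^ (-N : ℤ)), f w * (diffConst s n / nodeProd s n m w) := by
  have hR : (0 : ℝ) < s ^ (-N : ℤ) := zpow_pos hs _
  induction n with
  | zero =>
    intro m h1 h2
    have hm : node s m ∈ Metric.ball (0 : ℂ) (s ^ (-N : ℤ)) := by
      rw [mem_ball_zero_iff]
      exact norm_node_lt hs hs1 (by simpa using h1) (by simpa using h2)
    have := hf.diffContOnCl.two_pi_i_inv_smul_circleIntegral_sub_inv_smul hm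
    rw [Function.iterate_zero, id, ← this]
    congr 2
    funext w
    simp [diffConst, nodeProd, mul_comm]
  | succ n ih =>
    intro m h1 h2
    push_cast at h1 h2
    rw [Function.iterate_succ_apply', awD_node hs, ih _ (by omega) (by omega),
      ih _ (by omega) (by omega), ← smul_sub, ← circleIntegral.integral_sub, div_eq_inv_mul,
      mul_smul_comm, ← circleIntegral.integral_const_mul]
    · congr 1
      refine circleIntegral.integral_congr hR.le fun w hw => ?_
      have hw : ‖w‖ = s ^ (-N : ℤ) := by simpa using hw
      have n0 := nodeProd_ne_zero hs hs1 (n := n + 1) (m := m) hw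
        (by push_cast; omega) (by push_cast; omega)
      have k0 := sub_inv_ne_zero hs hs1
      have k1 := zpow_add_zpow_neg_ne_zero hs m
      have hsub := node_add_sub_node_sub hs m (n + 1 : ℕ)
      have ep : nodeProd s n (m + 1) w ≠ 0 := nodeProd_ne_zero hs hs1 hw (by omega) (by omega)
      have em : nodeProd s n (m - 1) w ≠ 0 := nodeProd_ne_zero hs hs1 hw (by omega) (by omega)
      have p1 := nodeProd_succ s n m w
      have p2 := nodeProd_succ' s n m w
      have key : 1 / nodeProd s n (m + 1) w - 1 / nodeProd s n (m - 1) w =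
          I / 2 * ((s : ℂ) ^ ((n + 1 : ℕ) : ℤ) - (s : ℂ) ^ (-(n + 1 : ℕ) : ℤ)) *
          ((s : ℂ) ^ m + (s : ℂ) ^ (-m)) / nodeProd s (n + 1) m w := by
        rw [← hsub, eq_div_iff n0, sub_mul]
        nth_rewrite 1 [p1]
        rw [p2]
        field_simp
        ring
      have hI := I_ne_zero
      calc _ = ((s - (s : ℂ)⁻¹) * (I / 2 * ((s : ℂ) ^ m + (s : ℂ) ^ (-m))))⁻¹ *
            (f w * diffConst s n * (1 / nodeProd s n (m + 1) w - 1 / nodeProd s n (m - 1) w)) := by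
            ring
        _ = _ := by
            rw [key, diffConst, diffConst, prod_range_succ]
            generalize (s : ℂ) ^ ((n + 1 : ℕ) : ℤ) - (s : ℂ) ^ (-(n + 1 : ℕ) : ℤ) = a
            generalize (s : ℂ) ^ m + (s : ℂ) ^ (-m) = b at *
            generalize (s : ℂ) - (s : ℂ)⁻¹ = c at *
            field_simp
    all_goals
      refine ContinuousOn.circleIntegrable hR.le ?_
      refine hf.continuous.continuousOn.mul
        (continuousOn_const.div (continuous_nodeProd s _ _).continuousOn fun w hw => ?_)
      have hw : ‖w‖ = s ^ (-N : ℤ) := by simpa using hw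
      exact nodeProd_ne_zero hs hs1 hw (by omega) (by omega)

/-- The normalisation of f_n undoes both `diffConst` and the 2^n relating ρ_n to its monic form. -/
theorem taylorCoeff_const {s : ℝ} (hs : 0 < s) (hs1 : s < 1) (n : ℕ) :
    (((s ^ 2) ^ (((n : ℝ) ^ 2 - n) / 4) : ℝ) : ℂ) * (1 - ((s ^ 2 : ℝ) : ℂ)) ^ n /
      (2 ^ n * qPoch ((s ^ 2 : ℝ) : ℂ) ((s ^ 2 : ℝ) : ℂ) n) * diffConst s n * 2 ^ n = 1 := by
  have hs' : (s : ℂ) ≠ 0 := by exact_mod_cast hs.ne'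
  induction n with
  | zero => simp [qPoch, diffConst]
  | succ n ih =>
    have e : ((s ^ 2) ^ ((((n + 1 : ℕ) : ℝ) ^ 2 - (n + 1 : ℕ)) / 4) : ℝ) =
        (s ^ 2) ^ (((n : ℝ) ^ 2 - n) / 4) * s ^ n := by
      rw [← Real.rpow_natCast s n, ← Real.rpow_natCast s 2, ← Real.rpow_mul hs.le,
        ← Real.rpow_mul hs.le, ← Real.rpow_add hs]
      congr 1
      push_cast
      ring
    have hq1 : s ^ 2 < 1 := by nlinarith
    have h1 : (1 : ℂ) - (s : ℂ) ^ 2 ≠ 0 := by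
      exact_mod_cast (by linarith : (0 : ℝ) < 1 - s ^ 2).ne'
    have h2 : (1 : ℂ) - (s : ℂ) ^ 2 * ((s : ℂ) ^ 2) ^ n ≠ 0 := by
      have : (s ^ 2) ^ n ≤ 1 := pow_le_one₀ (by positivity) hq1.le
      have : s ^ 2 * (s ^ 2) ^ n < 1 := by
        have h0 : 0 < s ^ 2 := by positivity
        nlinarith
      exact_mod_cast (by linarith : (0 : ℝ) < 1 - s ^ 2 * (s ^ 2) ^ n).ne'
    have h3 := sub_inv_ne_zero hs hs1
    have h4 : ((s : ℂ) ^ n) * (1 - (s : ℂ) ^ 2) / (1 - (s : ℂ) ^ 2 * ((s : ℂ) ^ 2) ^ n) *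
        (((s : ℂ) ^ ((n + 1 : ℕ) : ℤ) - (s : ℂ) ^ (-(n + 1 : ℕ) : ℤ)) / (s - (s : ℂ)⁻¹)) = 1 := by
      have h5 : (s : ℂ) - (s : ℂ)⁻¹ = -(1 - (s : ℂ) ^ 2) / s := by
        field_simp
        ring
      have h6 : (s : ℂ) ^ ((n + 1 : ℕ) : ℤ) - (s : ℂ) ^ (-(n + 1 : ℕ) : ℤ) =
          -(1 - (s : ℂ) ^ 2 * ((s : ℂ) ^ 2) ^ n) / s ^ (n + 1) := by
        rw [zpow_neg, zpow_natCast]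
        field_simp
        ring
      rw [h5, h6]
      field_simp
      ring
    refine Eq.trans ?_ ((congrArg₂ (· * ·) ih h4).trans (one_mul 1))
    rw [e, diffConst, prod_range_succ, ← diffConst, qPoch, prod_range_succ, ← qPoch]
    push_cast
    simp only [div_eq_mul_inv, mul_inv, pow_succ]
    ring

/-! ### Contour integrals for the terms and the remainder. -/

theorem taylorCoeff_mul_rho {s : ℝ} (hs : 0 < s) (hs1 : s < 1) {f : ℂ → ℂ}
    (hf : Differentiable ℂ f) (x : ℂ) {n N : ℕ} (hn : n < N) :
    taylorCoeff (s ^ 2) f n * rho (s ^ 2) n x = (2 * Real.pi * I : ℂ)⁻¹ •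
      ∮ w in C(0, s ^ (-N : ℤ)), f w * (w * nodal s n x / nodal s (n + 2) w) := by
  have hR : (0 : ℝ) < s ^ (-N : ℤ) := zpow_pos hs _
  have h := iterate_awD_node hs hs1 hf N n 0 (by omega) (by omega)
  rw [node_zero] at h
  have hc : ∮ w in C(0, s ^ (-N : ℤ)), f w * (w * nodal s n x / nodal s (n + 2) w) =
      nodal s n x • ∮ w in C(0, s ^ (-N : ℤ)), f w * (1 / nodeProd s n 0 w) := by
    rw [← circleIntegral.integral_smul]
    refine circleIntegral.integral_congr hR.le fun w hw => ?_
    have hw : ‖w‖ = s ^ (-N : ℤ) := by simpa using hw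
    have hw0 : w ≠ 0 := norm_ne_zero_iff.1 (hw ▸ hR.ne')
    have := nodeProd_ne_zero hs hs1 (n := n) (m := 0) hw (by omega) (by omega)
    simp only [smul_eq_mul]
    rw [← mul_nodeProd_zero]
    field_simp
  have hd : ∮ w in C(0, s ^ (-N : ℤ)), f w * (diffConst s n / nodeProd s n 0 w) =
      diffConst s n • ∮ w in C(0, s ^ (-N : ℤ)), f w * (1 / nodeProd s n 0 w) := by
    rw [← circleIntegral.integral_smul]
    refine circleIntegral.integral_congr hR.le fun w hw => ?_
    simp only [smul_eq_mul]
    ring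
  rw [taylorCoeff, h, hc, hd, rho_eq_nodal hs]
  simp only [smul_eq_mul]
  linear_combination (nodal s n x * ((2 * Real.pi * I : ℂ)⁻¹ *
    ∮ w in C(0, s ^ (-N : ℤ)), f w * (1 / nodeProd s n 0 w))) * taylorCoeff_const hs hs1 n

theorem sub_sum_taylor_eq {s : ℝ} (hs : 0 < s) (hs1 : s < 1) {f : ℂ → ℂ}
    (hf : Differentiable ℂ f) {x : ℂ} {N : ℕ} (hx : ‖x‖ < s ^ (-N : ℤ)) :
    f x - ∑ n ∈ range N, taylorCoeff (s ^ 2) f n * rho (s ^ 2) n x = (2 * Real.pi * I : ℂ)⁻¹ •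
      ∮ w in C(0, s ^ (-N : ℤ)), f w *
        (w * (nodal s N x / nodal s N w + nodal s (N + 1) x / nodal s (N + 1) w) /
          (w ^ 2 - x ^ 2)) := by
  have hR : (0 : ℝ) < s ^ (-N : ℤ) := zpow_pos hs _
  have hwx {w : ℂ} (hw : ‖w‖ = s ^ (-N : ℤ)) : w ^ 2 - x ^ 2 ≠ 0 := fun h0 => by
    have h2 : ‖w‖ ^ 2 = ‖x‖ ^ 2 := by rw [← norm_pow, ← norm_pow, sub_eq_zero.1 h0]
    rw [hw] at h2
    exact hx.ne' ((pow_left_inj₀ hR.le (norm_nonneg _) two_ne_zero).1 h2)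
  have h := hf.diffContOnCl.two_pi_i_inv_smul_circleIntegral_sub_inv_smul
    (mem_ball_zero_iff.2 hx)
  have hcn : ∀ n, ContinuousOn (nodal s n) (Metric.sphere (0 : ℂ) (s ^ (-N : ℤ))) := fun n =>
    (continuous_nodal s n).continuousOn
  have hfc : ContinuousOn f (Metric.sphere (0 : ℂ) (s ^ (-N : ℤ))) := hf.continuous.continuousOn
  have hI : ∀ n ∈ range N, CircleIntegrable
      (fun w => f w * (w * nodal s n x / nodal s (n + 2) w)) 0 (s ^ (-N : ℤ)) := by
    intro n hn
    refine ContinuousOn.circleIntegrable hR.le (hfc.mul (ContinuousOn.div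
      (continuousOn_id.mul continuousOn_const) (hcn _) fun w hw => ?_))
    exact nodal_ne_zero hs hs1 (by simpa using hw) _ (by have := mem_range.1 hn; omega)
  have hI2 : CircleIntegrable (fun w => f w *
        (w * (nodal s N x / nodal s N w + nodal s (N + 1) x / nodal s (N + 1) w) /
          (w ^ 2 - x ^ 2))) 0 (s ^ (-N : ℤ)) := by
    have hc : ContinuousOn (fun w : ℂ => w ^ 2 - x ^ 2)
        (Metric.sphere (0 : ℂ) (s ^ (-N : ℤ))) := by fun_prop
    refine ContinuousOn.circleIntegrable hR.le (hfc.mul (ContinuousOn.div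
      (continuousOn_id.mul (ContinuousOn.add ?_ ?_)) hc fun w hw => hwx (by simpa using hw)))
    · exact continuousOn_const.div (hcn _) fun w hw =>
        nodal_ne_zero hs hs1 (by simpa using hw) _ (by omega)
    · exact continuousOn_const.div (hcn _) fun w hw =>
        nodal_ne_zero hs hs1 (by simpa using hw) _ (by omega)
  rw [← h, sum_congr rfl fun n hn => taylorCoeff_mul_rho hs hs1 hf x (mem_range.1 hn),
    ← smul_sum, ← smul_sub, ← circleIntegral.integral_fun_sum hI, ← circleIntegral.integral_sub]
  · congr 1
    refine circleIntegral.integral_congr hR.le fun w hw => ?_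
    have hw : ‖w‖ = s ^ (-N : ℤ) := by simpa using hw
    simp only [smul_eq_mul]
    rw [inv_sub_eq_sum_nodal N (hwx hw) (nodal_ne_zero hs hs1 hw), add_mul, sum_mul,
      sum_congr rfl fun n _ => mul_comm _ (f w)]
    ring
  · refine ContinuousOn.circleIntegrable hR.le (ContinuousOn.smul (ContinuousOn.inv₀
      (continuousOn_id.sub continuousOn_const) fun w hw h0 => ?_) hfc)
    exact hwx (by simpa using hw) (by rw [sub_eq_zero.1 (show w - x = 0 from h0), sub_self])
  · exact (CircleIntegrable.sum _ hI).congr fun θ _ => by simp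

/-! ### Growth estimates. -/

open Filter

theorem zpow_neg_eq_exp {l : ℝ} (n : ℕ) : Real.exp (-l) ^ (-n : ℤ) = Real.exp (n * l) := by
  rw [zpow_neg, zpow_natCast, ← Real.exp_nat_mul, ← Real.exp_neg]
  congr 1
  ring

/-- Each factor is at most exp(2ln)/4 · (1 + 4|x|² exp(-2ln)). The decaying term B exp(-2ln) in the
exponent lets the induction absorb these corrections, so the constant is uniform in n. -/
theorem norm_nodal_le {l : ℝ} (hl : 0 < l) {x : ℂ} {B : ℝ} (hB0 : 0 ≤ B)
    (hB : 4 * ‖x‖ ^ 2 ≤ B * (1 - Real.exp (-2 * l))) :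
    ∀ n : ℕ, ‖nodal (Real.exp (-l)) n x‖ ≤ (1 + 2 * ‖x‖) * Real.exp B *
      Real.exp (l * ((n : ℝ) - 1) ^ 2 / 2 - n * Real.log 2 - B * Real.exp (-2 * l * n))
  | 0 => by
    have h : 1 ≤ Real.exp B * Real.exp (l / 2 - B) := by
      rw [← Real.exp_add, Real.one_le_exp_iff]
      linarith
    have : 0 ≤ ‖x‖ := norm_nonneg x
    simp only [nodal, norm_one, Nat.cast_zero, mul_zero, Real.exp_zero, zero_sub, neg_sq, one_pow,
      zero_mul, sub_zero, mul_one]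
    rw [mul_assoc]
    nlinarith
  | 1 => by
    have h : 1 / 2 ≤ Real.exp B * Real.exp (-Real.log 2 - B * Real.exp (-2 * l)) := by
      rw [← Real.exp_add, show B + (-Real.log 2 - B * Real.exp (-2 * l)) =
        -Real.log 2 + B * (1 - Real.exp (-2 * l)) by ring, Real.exp_add, Real.exp_neg,
        Real.exp_log two_pos]
      have : 1 ≤ Real.exp (B * (1 - Real.exp (-2 * l))) :=
        Real.one_le_exp ((by positivity : 0 ≤ 4 * ‖x‖ ^ 2).trans hB)
      linarith
    have : 0 ≤ ‖x‖ := norm_nonneg x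
    simp only [nodal, Nat.cast_one, sub_self, mul_one, one_mul, ne_eq, OfNat.ofNat_ne_zero,
      not_false_eq_true, zero_pow, mul_zero, zero_div, zero_sub]
    rw [mul_assoc]
    nlinarith
  | n + 2 => by
    have ih := norm_nodal_le hl hB0 hB n
    have hs1 : Real.exp (-l) < 1 := Real.exp_lt_one_iff.2 (by linarith)
    have hn := norm_node_le (Real.exp_pos _) hs1 n
    rw [zpow_neg_eq_exp] at hn
    have h1 : ‖x ^ 2 - node (Real.exp (-l)) n ^ 2‖ ≤
        Real.exp (2 * l * n - 2 * Real.log 2) * Real.exp (4 * ‖x‖ ^ 2 * Real.exp (-2 * l * n)) := by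
      calc _ ≤ ‖x‖ ^ 2 + (Real.exp (n * l) / 2) ^ 2 := by
            refine (norm_sub_le _ _).trans ?_
            rw [norm_pow, norm_pow]
            gcongr
        _ = Real.exp (2 * l * n) / 4 * (4 * ‖x‖ ^ 2 * Real.exp (-2 * l * n) + 1) := by
            have e1 : Real.exp (n * l) ^ 2 = Real.exp (2 * l * n) := by
              rw [← Real.exp_nat_mul]
              congr 1
              push_cast
              ring
            have e2 : Real.exp (2 * l * n) * Real.exp (-2 * l * n) = 1 := by
              rw [← Real.exp_add, ← Real.exp_zero]
              congr 1
              ring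
            rw [div_pow, e1]
            linear_combination -‖x‖ ^ 2 * e2
        _ ≤ Real.exp (2 * l * n) / 4 * Real.exp (4 * ‖x‖ ^ 2 * Real.exp (-2 * l * n)) := by
            gcongr
            exact Real.add_one_le_exp _
        _ = _ := by
            rw [Real.exp_sub, show 2 * Real.log 2 = Real.log 2 + Real.log 2 by ring, Real.exp_add,
              Real.exp_log two_pos]
            norm_num
    rw [nodal, norm_mul]
    refine (mul_le_mul ih h1 (norm_nonneg _) (by positivity)).trans ?_
    rw [mul_assoc]
    refine mul_le_mul_of_nonneg_left ?_ (by positivity)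
    rw [← Real.exp_add, ← Real.exp_add]
    refine Real.exp_le_exp.2 ?_
    have e : Real.exp (-2 * l * (n + 2 : ℕ)) ≤ Real.exp (-2 * l * n) * Real.exp (-2 * l) := by
      rw [← Real.exp_add]
      refine Real.exp_le_exp.2 ?_
      push_cast
      linarith
    have e0 := Real.exp_pos (-2 * l * n)
    have e1 := mul_le_mul_of_nonneg_right hB e0.le
    have e2 := mul_le_mul_of_nonneg_left e hB0
    push_cast at e2 ⊢
    nlinarith

/-- Each factor is at least |w|² (1 - y/4) with y = exp(-2l(N - n)). The loss grows geometrically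
with n, so the term with A absorbs the accumulated loss; it stays bounded up to n = N + 1. -/
theorem le_norm_nodal {l : ℝ} (hl : 0 < l) {N : ℕ} {w : ℂ} (hw : ‖w‖ = Real.exp (N * l)) {A : ℝ}
    (hA0 : 0 ≤ A) (hA : 1 ≤ 2 * A * (Real.exp (4 * l) - 1)) :
    ∀ n ≤ N + 1, Real.exp (n * (N * l) - A * Real.exp (-2 * l * (N - n))) ≤
      ‖nodal (Real.exp (-l)) n w‖
  | 0, _ => by
    simp only [nodal, norm_one, Real.exp_le_one_iff, Nat.cast_zero, zero_mul, sub_zero, zero_sub,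
      Left.neg_nonpos_iff]
    positivity
  | 1, _ => by
    rw [nodal, hw, Real.exp_le_exp]
    have := Real.exp_pos (-2 * l * (N - (1 : ℕ)))
    push_cast at *
    nlinarith
  | n + 2, h => by
    have ih := le_norm_nodal hl hw hA0 hA n (by omega)
    have hs1 : Real.exp (-l) < 1 := Real.exp_lt_one_iff.2 (by linarith)
    have hn := norm_node_le (Real.exp_pos _) hs1 n
    rw [zpow_neg_eq_exp] at hn
    have hnN : (n : ℝ) ≤ N := by exact_mod_cast (by omega : n ≤ N)
    set y := Real.exp (-2 * l * (N - n)) with hy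
    have hy0 : 0 < y := Real.exp_pos _
    have hy1 : y ≤ 1 := Real.exp_le_one_iff.2 (by nlinarith)
    have h1 : Real.exp (2 * (N * l)) * Real.exp (-(y / 2)) ≤
        ‖w ^ 2 - node (Real.exp (-l)) n ^ 2‖ := by
      -- For 0 < y ≤ 1, exp(-y/2) ≤ 1/(1 + y/2) ≤ 1 - y/4.
      calc _ ≤ Real.exp (2 * (N * l)) * (1 - y / 4) := by
            gcongr
            rw [Real.exp_neg]
            refine inv_le_of_inv_le₀ (by linarith) ?_
            refine le_trans ?_ (Real.add_one_le_exp _)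
            rw [inv_le_iff_one_le_mul₀ (by linarith)]
            nlinarith
        _ = ‖w‖ ^ 2 - (Real.exp (n * l) / 2) ^ 2 := by
            rw [hw, div_pow, ← Real.exp_nat_mul, ← Real.exp_nat_mul, mul_sub, mul_one,
              mul_div_assoc', hy, ← Real.exp_add]
            push_cast
            norm_num
            ring_nf
        _ ≤ ‖w‖ ^ 2 - ‖node (Real.exp (-l)) n‖ ^ 2 := by gcongr
        _ ≤ _ := by
            rw [← norm_pow, ← norm_pow]
            exact norm_sub_norm_le _ _
    rw [nodal, norm_mul]
    refine le_trans ?_ (mul_le_mul ih h1 (by positivity) (norm_nonneg _))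
    rw [← Real.exp_add, ← Real.exp_add]
    refine Real.exp_le_exp.2 ?_
    have e : Real.exp (-2 * l * (N - (n + 2 : ℕ))) = Real.exp (4 * l) * y := by
      rw [hy, ← Real.exp_add]
      congr 1
      push_cast
      ring
    rw [e]
    push_cast
    nlinarith

/-- Geometric bound for the remainder, where `q = exp (-2 l)` and `f` is bounded by
`K |x| ^ α exp (ln² |x| / ln q⁻¹)` on the circles `|x| = q ^ (-N / 2)`. -/
theorem norm_sub_sum_taylor_le {l : ℝ} (hl : 0 < l) {f : ℂ → ℂ} (hf : Differentiable ℂ f)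
    {K α : ℝ} (hfK : ∀ (N : ℕ) (w : ℂ), ‖w‖ = Real.exp (N * l) →
      ‖f w‖ ≤ K * Real.exp (α * (N * l) + N ^ 2 * l / 2)) (x : ℂ) :
    ∃ C : ℝ, ∀ N : ℕ, 2 * ‖x‖ ≤ Real.exp (N * l) →
      ‖f x - ∑ n ∈ range N,
        taylorCoeff (Real.exp (-l) ^ 2) f n * rho (Real.exp (-l) ^ 2) n x‖ ≤
      C * Real.exp (α * l - Real.log 2) ^ N := by
  have hq1 : Real.exp (-2 * l) < 1 := Real.exp_lt_one_iff.2 (by linarith)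
  have hq2 : 1 < Real.exp (4 * l) := Real.one_lt_exp_iff.2 (by linarith)
  obtain ⟨B, hB0, hB⟩ : ∃ B : ℝ, 0 ≤ B ∧ 4 * ‖x‖ ^ 2 ≤ B * (1 - Real.exp (-2 * l)) :=
    ⟨4 * ‖x‖ ^ 2 / (1 - Real.exp (-2 * l)), div_nonneg (by positivity) (by linarith),
      (div_mul_cancel₀ _ (by linarith)).ge⟩
  obtain ⟨A, hA0, hA⟩ : ∃ A : ℝ, 0 ≤ A ∧ 1 ≤ 2 * A * (Real.exp (4 * l) - 1) := by
    refine ⟨1 / (2 * (Real.exp (4 * l) - 1)), div_nonneg zero_le_one (by linarith), le_of_eq ?_⟩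
    have : Real.exp (4 * l) - 1 ≠ 0 := by linarith
    field_simp
  set D := (1 + 2 * ‖x‖) * Real.exp B with hD
  have hD0 : 0 ≤ D := by positivity
  set A' := A * Real.exp (2 * l) with hA'
  have hK : 0 ≤ K := by
    have h := (norm_nonneg _).trans (hfK 0 1 (by simp))
    simpa using h
  have hs1 : Real.exp (-l) < 1 := Real.exp_lt_one_iff.2 (by linarith)
  -- Two boundary terms, and a factor 2 from |w² - x²| ≥ |w|²/2, give the 4.
  refine ⟨4 * K * D * Real.exp (A' + l / 2), fun N hN => ?_⟩
  have hR0 := Real.exp_pos (N * l)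
  have hx0 := norm_nonneg x
  have hx : ‖x‖ < Real.exp (-l) ^ (-N : ℤ) := by
    rw [zpow_neg_eq_exp]
    linarith
  rw [sub_sum_taylor_eq (Real.exp_pos _) hs1 hf hx]
  have hle := circleIntegral.norm_two_pi_i_inv_smul_integral_le_of_norm_le_const
    (f := fun w => f w * (w * (nodal (Real.exp (-l)) N x / nodal (Real.exp (-l)) N w +
      nodal (Real.exp (-l)) (N + 1) x / nodal (Real.exp (-l)) (N + 1) w) / (w ^ 2 - x ^ 2)))
    (c := 0) (R := Real.exp (-l) ^ (-N : ℤ))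
    (C := 4 * K * D * Real.exp (A' + l / 2) * Real.exp (α * l - Real.log 2) ^ N *
      (Real.exp (N * l))⁻¹) (zpow_pos (Real.exp_pos _) _).le ?_
  · refine hle.trans_eq ?_
    rw [zpow_neg_eq_exp]
    field_simp
  intro w hw
  have hw : ‖w‖ = Real.exp (N * l) := by
    rw [← zpow_neg_eq_exp]
    simpa using hw
  have hratio (n : ℕ) (hn : n ≤ N + 1) :
      ‖nodal (Real.exp (-l)) n x / nodal (Real.exp (-l)) n w‖ ≤
        D * Real.exp (l * ((n : ℝ) - 1) ^ 2 / 2 - n * Real.log 2 - n * (N * l) + A') := by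
    rw [norm_div]
    have h1 := norm_nodal_le hl hB0 hB n
    have h2 := le_norm_nodal hl hw hA0 hA n hn
    refine (div_le_div₀ (by positivity) h1 (Real.exp_pos _) h2).trans ?_
    rw [mul_div_assoc, ← Real.exp_sub]
    refine mul_le_mul_of_nonneg_left (Real.exp_le_exp.2 ?_) hD0
    have e1 : A * Real.exp (-2 * l * (N - n)) ≤ A' := by
      refine mul_le_mul_of_nonneg_left (Real.exp_le_exp.2 ?_) hA0
      have : (n : ℝ) ≤ N + 1 := by exact_mod_cast hn
      nlinarith
    have e2 := mul_nonneg hB0 (Real.exp_pos (-2 * l * n)).le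
    linarith
  have hlog := Real.log_pos one_lt_two
  have hden : Real.exp (N * l) ^ 2 / 2 ≤ ‖w ^ 2 - x ^ 2‖ := by
    refine le_trans ?_ (norm_sub_norm_le _ _)
    rw [norm_pow, norm_pow, hw]
    nlinarith
  have hprod (n : ℕ) (hn : n = N ∨ n = N + 1) :
      ‖f w‖ * ‖nodal (Real.exp (-l)) n x / nodal (Real.exp (-l)) n w‖ ≤
        K * D * Real.exp (A' + l / 2) * Real.exp (α * l - Real.log 2) ^ N := by
    refine (mul_le_mul (hfK N w hw) (hratio n (by omega)) (norm_nonneg _)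
      (by positivity)).trans ?_
    rw [mul_mul_mul_comm, ← Real.exp_add, ← Real.exp_nat_mul, mul_assoc (K * D), ← Real.exp_add]
    refine mul_le_mul_of_nonneg_left (Real.exp_le_exp.2 ?_) (mul_nonneg hK hD0)
    -- Both exponents contain a spare -Nl, which is discarded here.
    have hNl : 0 ≤ (N : ℝ) * l := by positivity
    rcases hn with rfl | rfl
    · nlinarith
    · push_cast
      nlinarith
  rw [norm_mul, norm_div, norm_mul, hw]
  calc _ ≤ ‖f w‖ * (Real.exp (N * l) *
        (‖nodal (Real.exp (-l)) N x / nodal (Real.exp (-l)) N w‖ +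
          ‖nodal (Real.exp (-l)) (N + 1) x / nodal (Real.exp (-l)) (N + 1) w‖) /
          (Real.exp (N * l) ^ 2 / 2)) := by
        gcongr
        exact norm_add_le _ _
    _ = 2 * (‖f w‖ * ‖nodal (Real.exp (-l)) N x / nodal (Real.exp (-l)) N w‖ +
          ‖f w‖ * ‖nodal (Real.exp (-l)) (N + 1) x / nodal (Real.exp (-l)) (N + 1) w‖) *
          (Real.exp (N * l))⁻¹ := by
        field_simp
    _ ≤ 2 * (K * D * Real.exp (A' + l / 2) * Real.exp (α * l - Real.log 2) ^ N +
          K * D * Real.exp (A' + l / 2) * Real.exp (α * l - Real.log 2) ^ N) *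
          (Real.exp (N * l))⁻¹ := by
        have h1 := add_le_add (hprod N (.inl rfl)) (hprod (N + 1) (.inr rfl))
        gcongr 2 * ?_ * _
    _ = _ := by ring

/-! ### Convergence and conclusion. -/

/-- A term is the difference of consecutive remainders, so it too decays geometrically, which gives
absolute convergence. -/
theorem hasSum_of_norm_sub_sum_le {a : ℕ → ℂ} {b : ℂ} {C θ : ℝ} (hθ0 : 0 ≤ θ) (hθ1 : θ < 1)
    (h : ∀ᶠ N in atTop, ‖b - ∑ n ∈ range N, a n‖ ≤ C * θ ^ N) : HasSum a b := by
  have hs : Summable a := by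
    refine summable_of_isBigO_nat (summable_geometric_of_lt_one hθ0 hθ1)
      (Asymptotics.IsBigO.of_bound (C + C * θ) ?_)
    filter_upwards [h, (tendsto_add_atTop_nat 1).eventually h] with N h1 h2
    rw [sum_range_succ] at h2
    rw [Real.norm_of_nonneg (by positivity)]
    calc ‖a N‖ = ‖(b - ∑ n ∈ range N, a n) - (b - (∑ n ∈ range N, a n + a N))‖ := by
          congr 1
          ring
      _ ≤ C * θ ^ N + C * θ ^ (N + 1) := (norm_sub_le _ _).trans (add_le_add h1 h2)
      _ = (C + C * θ) * θ ^ N := by ring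
  rw [hs.hasSum_iff_tendsto_nat]
  have h0 : Tendsto (fun N => C * θ ^ N) atTop (nhds 0) := by
    simpa using (tendsto_pow_atTop_nhds_zero_of_lt_one hθ0 hθ1).const_mul C
  have := squeeze_zero_norm' h h0
  simpa using this.const_sub b

theorem hasSum_taylorCoeff_mul_rho {l : ℝ} (hl : 0 < l) {f : ℂ → ℂ} (hf : Differentiable ℂ f)
    {K α : ℝ} (hα : α * l < Real.log 2) (hfK : ∀ (N : ℕ) (w : ℂ), ‖w‖ = Real.exp (N * l) →
      ‖f w‖ ≤ K * Real.exp (α * (N * l) + N ^ 2 * l / 2)) (x : ℂ) :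
    HasSum (fun k => taylorCoeff (Real.exp (-l) ^ 2) f k * rho (Real.exp (-l) ^ 2) k x) (f x) := by
  obtain ⟨C, hC⟩ := norm_sub_sum_taylor_le hl hf hfK x
  refine hasSum_of_norm_sub_sum_le (C := C) (Real.exp_pos (α * l - Real.log 2)).le
    (Real.exp_lt_one_iff.2 (by linarith)) ?_
  have ht : Tendsto (fun N : ℕ => Real.exp (N * l)) atTop atTop :=
    Real.tendsto_exp_atTop.comp (tendsto_natCast_atTop_atTop.atTop_mul_const hl)
  filter_upwards [ht.eventually_ge_atTop (2 * ‖x‖)] with N hN using hC N hN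

end AskeyWilson

end

theorem mainTheorem3 (q : ℝ) (hq0 : 0 < q) (hq1 : q < 1) (f : ℂ → ℂ)
    (hf : (∃ k α : ℝ, k < 2 * Real.log q⁻¹ ∧ AskeyWilson.HasQExpGrowth q k α f) ∨
      (∃ α : ℝ, α < 2 * Real.log 2 / Real.log q⁻¹ ∧
        AskeyWilson.HasQExpGrowth q (2 * Real.log q⁻¹) α f)) :
    ∀ x : ℂ, HasSum (fun k : ℕ => AskeyWilson.taylorCoeff q f k * AskeyWilson.rho q k x) (f x) := by
  intro x
  obtain ⟨l, hl, rfl⟩ : ∃ l : ℝ, 0 < l ∧ Real.exp (-l) ^ 2 = q := by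
    refine ⟨-Real.log q / 2, by linarith [Real.log_neg hq0 hq1], ?_⟩
    rw [← Real.exp_nat_mul]
    push_cast
    rw [show 2 * -(-Real.log q / 2) = Real.log q by ring, Real.exp_log hq0]
  have hlog : Real.log (Real.exp (-l) ^ 2) = -(2 * l) := by
    rw [Real.log_pow, Real.log_exp]
    push_cast
    ring
  rw [Real.log_inv, hlog, neg_neg] at hf
  have hgrow {k α : ℝ} (h : AskeyWilson.HasQExpGrowth (Real.exp (-l) ^ 2) k α f) :
      ∃ K : ℝ, 0 < K ∧ ∀ (N : ℕ) (w : ℂ), ‖w‖ = Real.exp (N * l) →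
        ‖f w‖ ≤ K * Real.exp (α * (N * l) + k * (N : ℝ) ^ 2 / 8) := by
    obtain ⟨-, K, hK, h⟩ := h
    refine ⟨K, hK, fun N w hw => ?_⟩
    have hw0 : w ≠ 0 := norm_ne_zero_iff.1 (hw ▸ (Real.exp_pos _).ne')
    refine (h w hw0).le.trans_eq ?_
    rw [hw, Real.log_exp, hlog, ← Real.exp_mul, mul_assoc, ← Real.exp_add]
    congr 2
    field_simp
    ring
  have hlog2 := Real.log_pos one_lt_two
  rcases hf with ⟨k, α, hk, h⟩ | ⟨α, hα, h⟩
  · obtain ⟨K, hK, hb⟩ := hgrow h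
    have hε : 0 < l / 2 - k / 8 := by linarith
    -- Below the critical order the gap (l/2 - k/8)N² absorbs the linear term αNl; completing the
    -- square gives the constant and reduces to critical order with type 0.
    refine AskeyWilson.hasSum_taylorCoeff_mul_rho (α := 0)
      (K := K * Real.exp ((α * l) ^ 2 / (4 * (l / 2 - k / 8)))) hl h.1 (by simpa using hlog2)
      (fun N w hw => (hb N w hw).trans ?_) x
    rw [mul_assoc, ← Real.exp_add]
    refine mul_le_mul_of_nonneg_left (Real.exp_le_exp.2 ?_) hK.le
    have hsq : 0 ≤ (2 * (l / 2 - k / 8) * N - α * l) ^ 2 / (4 * (l / 2 - k / 8)) := by positivity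
    have e : (2 * (l / 2 - k / 8) * N - α * l) ^ 2 / (4 * (l / 2 - k / 8)) =
        (l / 2 - k / 8) * N ^ 2 - α * l * N + (α * l) ^ 2 / (4 * (l / 2 - k / 8)) := by
      generalize l / 2 - k / 8 = ε at *
      field_simp
      ring
    rw [e] at hsq
    linarith
  · obtain ⟨K, hK, hb⟩ := hgrow h
    refine AskeyWilson.hasSum_taylorCoeff_mul_rho (α := α) (K := K) hl h.1 ?_
      (fun N w hw => (hb N w hw).trans_eq ?_) x
    · rw [lt_div_iff₀ (by positivity)] at hα
      linarith
    · congr 3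
      ring
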